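/- Let $\mathbb{P}=\{1,2,\dots\}$. Let $G$ be a finite simple digraph (no loops, at most one edge from $a$ to $b$) each of whose edges has one of three colours, written $a\dashrightarrow b$, $a\rightarrow b$, $a\Rightarrow b$, and let $L:V(G)\to[n]=\{1,\dots,n\}$, $n=|V(G)|$, be a bijective labelling of its vertices. A proper vertex-colouring of $G$ is a map $\kappa:V(G)\to\mathbb{P}$ such that $\kappa(a)\neq\kappa(b)$ if $a\dashrightarrow b$, $\kappa(a)<\kappa(b)$ if $a\rightarrow b$, and $\kappa(a)\le\kappa(b)$ if $a\Rightarrow b$. Put $$\mathscr{Y}_{(G,L)}(\mathbf{x})=\sum_{\kappa}\mathbf{x}_{\kappa(L^{-1}(1))}\mathbf{x}_{\kappa(L^{-1}(2))}\cdots\mathbf{x}_{\kappa(L^{-1}(n))},$$ the sum over all proper vertex-colourings $\kappa$ of $G$, as a formal power series over $\mathbb{Q}$ in noncommuting variables $\mathbf{x}_1,\mathbf{x}_2,\dots$. It lies in $\mathrm{NCQSym}(\mathbf{x})$, the space of series $f$ of bounded degree such that, for every set composition $\Phi=(\Phi_1|\cdots|\Phi_k)$ of $[m]$, all monomials $\mathbf{x}_{i_1}\cdots\mathbf{x}_{i_m}$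 with $i_j=i_\ell$ for $j,\ell$ in the same block and $i_j<i_\ell$ for $j\in\Phi_p$, $\ell\in\Phi_q$, $p<q$, have the same coefficient in $f$. The coproduct $\Delta:\mathrm{NCQSym}(\mathbf{x})\to\mathrm{NCQSym}(\mathbf{x})\otimes\mathrm{NCQSym}(\mathbf{x})$ is defined as follows: evaluate $f$ at the linearly ordered noncommuting variables $\mathbf{x}_1<\mathbf{x}_2<\cdots<\mathbf{y}_1<\mathbf{y}_2<\cdots$ (the coefficient of a monomial being determined by its set composition), impose the relations $\mathbf{x}_i\mathbf{y}_j=\mathbf{y}_j\mathbf{x}_i$ for all $i,j$, write the result as a finite sum $\sum \bar f_1(\mathbf{x})\bar f_2(\mathbf{y})$ with $\bar f_1,\bar f_2$ in $\mathrm{NCQSym}$, and set $\Delta(f)=\sum\bar f_1\otimes\bar f_2$. For $A\subseteq V(G)$ let $G|_A$ be the induced subdigraph on $A$ with the edge colours of $G$, and let $L_A:A\to[|A|]$ be $L_A(a)=\mathrm{std}_{L(A)}(L(a))$, where $\mathrm{std}_B:B\to[|B|]$ is the order preserving bijection. A $\{\rightarrow,\Rightarrow\}$-induced subdigraph of $G$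 is an induced subdigraph $F$ such that $a\in V(F)$ and ($a\rightarrow b$ or $a\Rightarrow b$ in $G$) imply $b\in V(F)$ (the empty one and $G$ itself are allowed). Then $$\Delta\bigl(\mathscr{Y}_{(G,L)}(\mathbf{x})\bigr)=\sum_F \mathscr{Y}_{(G|_{V(G)-V(F)},\,L_{V(G)-V(F)})}(\mathbf{x})\otimes\mathscr{Y}_{(F,\,L_{V(F)})}(\mathbf{x}),$$ where the sum runs over all $\{\rightarrow,\Rightarrow\}$-induced subdigraphs $F$ of $G$. -/

import Mathlib

open scoped TensorProduct

namespace NCQ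

/-! ### Quasisymmetric functions in noncommuting variables -/

/-- Formal power series over `ℚ` in noncommuting variables indexed by `A`: a word
`[a₁, …, aₙ]` is the monomial `x_{a₁} ⋯ x_{aₙ}`, and a series is its family of coefficients. -/
abbrev NCSeries (A : Type) : Type := List A → ℚ

/-- A set composition `(Φ₁|Φ₂|⋯|Φₖ)` of an `n`-element set (here `{0, …, n-1}`). -/
structure SetComposition (n : ℕ) where
  blocks : List (Finset (Fin n))
  nonempty : ∀ B ∈ blocks, B.Nonempty
  disjoint : blocks.Pairwise Disjoint
  cover : ∀ j, ∃ B ∈ blocks, j ∈ B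

/-- The indices `i₁, …, iₙ` of a monomial fit the set composition `Φ`: they agree on each block,
and they are smaller on an earlier block than on a later one. -/
def SetComposition.Fits {n : ℕ} (Φ : SetComposition n) {A : Type} [LinearOrder A]
    (i : Fin n → A) : Prop :=
  (∀ B ∈ Φ.blocks, ∀ j ∈ B, ∀ l ∈ B, i j = i l) ∧
    Φ.blocks.Pairwise fun B C => ∀ j ∈ B, ∀ l ∈ C, i j < i l

/-- `NCQSym` in noncommuting variables indexed by a linearly ordered alphabet `A`: series of
bounded degree in which, for each set composition, all monomials fitting it have the same
coefficient. -/
def NCQSym (A : Type) [LinearOrder A] : Submodule ℚ (NCSeries A) where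
  carrier := {f | (∃ N : ℕ, ∀ w : List A, N < w.length → f w = 0) ∧
    ∀ (n : ℕ) (Φ : SetComposition n) (i i' : Fin n → A), Φ.Fits i → Φ.Fits i' →
      f (List.ofFn i) = f (List.ofFn i')}
  zero_mem' := ⟨⟨0, fun _ _ => rfl⟩, fun _ _ _ _ _ _ => rfl⟩
  add_mem' := by
    rintro f g ⟨⟨N, hN⟩, hf⟩ ⟨⟨M, hM⟩, hg⟩
    refine ⟨⟨max N M, fun w hw => ?_⟩, fun n Φ i i' h h' => ?_⟩
    · simp [hN w (by omega), hM w (by omega)]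
    · simp [hf n Φ i i' h h', hg n Φ i i' h h']
  smul_mem' := by
    rintro c f ⟨⟨N, hN⟩, hf⟩
    refine ⟨⟨N, fun w hw => ?_⟩, fun n Φ i i' h h' => ?_⟩
    · simp [hN w hw]
    · simp [hf n Φ i i' h h']

theorem SetComposition.Fits.lt_iff {n : ℕ} {Φ : SetComposition n} {A B : Type} [LinearOrder A]
    [LinearOrder B] {i : Fin n → A} {i' : Fin n → B} (h : Φ.Fits i) (h' : Φ.Fits i')
    (j l : Fin n) : i j < i l ↔ i' j < i' l := by
  obtain ⟨P, hP, hj⟩ := Φ.cover j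
  obtain ⟨Q, hQ, hl⟩ := Φ.cover l
  obtain ⟨p, hp, rfl⟩ := List.getElem_of_mem hP
  obtain ⟨q, hq, rfl⟩ := List.getElem_of_mem hQ
  rcases lt_trichotomy p q with hpq | rfl | hpq
  · have h1 := List.pairwise_iff_getElem.1 h.2 p q hp hq hpq j hj l hl
    have h2 := List.pairwise_iff_getElem.1 h'.2 p q hp hq hpq j hj l hl
    exact iff_of_true h1 h2
  · have h1 := h.1 _ hP j hj l hl
    have h2 := h'.1 _ hP j hj l hl
    simp [h1, h2]
  · have h1 := List.pairwise_iff_getElem.1 h.2 q p hq hp hpq l hl j hj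
    have h2 := List.pairwise_iff_getElem.1 h'.2 q p hq hp hpq l hl j hj
    exact iff_of_false h1.asymm h2.asymm

/-! ### The coproduct -/

/-- Replace each letter of a word by its rank (`1, 2, …`) among the letters of the word. -/
def pack {A : Type} [LinearOrder A] (w : List A) : List ℕ+ :=
  w.map fun a => Nat.succPNat (w.toFinset.filter (· < a)).card

@[simp] theorem length_pack {A : Type} [LinearOrder A] (w : List A) :
    (pack w).length = w.length := by simp [pack]

theorem pack_map {A B : Type} [LinearOrder A] [LinearOrder B] (φ : A → B) (w : List A)
    (h : StrictMonoOn φ {a | a ∈ w}) : pack (w.map φ) = pack w := by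
  unfold pack
  rw [List.map_map]
  refine List.map_congr_left fun a ha => ?_
  simp only [Function.comp]
  congr 1
  symm
  refine Finset.card_bij (fun b _ => φ b) ?_ ?_ ?_
  · intro b hb
    simp only [Finset.mem_filter, List.mem_toFinset] at hb
    simp only [Finset.mem_filter, List.mem_toFinset, List.mem_map]
    exact ⟨⟨b, hb.1, rfl⟩, h hb.1 ha hb.2⟩
  · intro b hb c hc hbc
    simp only [Finset.mem_filter, List.mem_toFinset] at hb hc
    exact h.injOn hb.1 hc.1 hbc
  · intro c hc
    simp only [Finset.mem_filter, List.mem_toFinset, List.mem_map] at hc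
    obtain ⟨⟨b, hb, rfl⟩, hlt⟩ := hc
    exact ⟨b, by simpa using ⟨hb, (h.lt_iff_lt hb ha).1 hlt⟩, rfl⟩

theorem pack_ofFn_congr {A B : Type} [LinearOrder A] [LinearOrder B] {n : ℕ} {i : Fin n → A}
    {i' : Fin n → B} (h : ∀ j l, i j < i l ↔ i' j < i' l) :
    pack (List.ofFn i) = pack (List.ofFn i') := by
  rcases n with _ | n
  · simp [pack]
  have heq : ∀ j l, i j = i l → i' j = i' l := fun j l e => by
    apply le_antisymm
    · exact not_lt.1 fun hl => absurd ((h l j).2 hl) (by simp [e])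
    · exact not_lt.1 fun hl => absurd ((h j l).2 hl) (by simp [e])
  have hφ : ∀ j, i' (Function.invFun i (i j)) = i' j := fun j =>
    heq _ _ (Function.invFun_eq ⟨j, rfl⟩)
  have hmap : List.ofFn i' = (List.ofFn i).map fun a => i' (Function.invFun i a) := by
    rw [List.map_ofFn]
    congr 1
    funext j
    exact (hφ j).symm
  rw [hmap, pack_map]
  rintro a ha b hb hab
  simp only [Set.mem_ofPred_eq, List.mem_ofFn'] at ha hb
  obtain ⟨j, rfl⟩ := ha
  obtain ⟨l, rfl⟩ := hb
  simpa only [hφ] using (h j l).1 hab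

/-- The identification of `NCQSym` in `x₁ < x₂ < ⋯` with `NCQSym` in a linearly ordered alphabet
`A`, i.e. the evaluation of `f` at `A`: the coefficient of a monomial is the one in `f` of the
monomial `x_{i₁} ⋯ x_{iₙ}` whose indices are the relative ranks of its letters, so that both fit
the same set composition. -/
def evalAt (A : Type) [LinearOrder A] : NCQSym ℕ+ →ₗ[ℚ] NCQSym A where
  toFun f := ⟨fun w => f.1 (pack w), by
    obtain ⟨⟨N, hN⟩, -⟩ := f.2
    exact ⟨⟨N, fun w hw => hN _ (by simpa using hw)⟩, fun n Φ i i' h h' =>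
      congrArg f.1 (pack_ofFn_congr (h.lt_iff h'))⟩⟩
  map_add' _ _ := rfl
  map_smul' _ _ := rfl

/-- The linearly ordered alphabet `x₁ < x₂ < ⋯ < y₁ < y₂ < ⋯`. -/
abbrev XY : Type := ℕ+ ⊕ₗ ℕ+

/-- The word formed by the `x`-letters of a word in the alphabet `XY`. -/
def xPart (w : List XY) : List ℕ+ := w.filterMap fun a => (ofLex a).getLeft?

/-- The word formed by the `y`-letters of a word in the alphabet `XY`. -/
def yPart (w : List XY) : List ℕ+ := w.filterMap fun a => (ofLex a).getRight?

/-- The monomials in `(x, y)` that become equal to `x_u y_v` once every `x`-variable commutes with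
every `y`-variable. -/
def fiber (u v : List ℕ+) : Set (List XY) := {w | xPart w = u ∧ yPart w = v}

theorem perm_parts (w : List XY) :
    w.Perm ((xPart w).map Sum.inlₗ ++ (yPart w).map Sum.inrₗ) := by
  induction w with
  | nil => simp [xPart, yPart]
  | cons a w ih =>
    rcases a with a | a
    · exact ih.cons _
    · exact (ih.cons _).trans List.perm_middle.symm

theorem fiber_finite (u v : List ℕ+) : (fiber u v).Finite := by
  refine ((u.map Sum.inlₗ ++ v.map Sum.inrₗ).permutations.toFinset.finite_toSet).subset ?_
  rintro w ⟨rfl, rfl⟩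
  simpa [List.mem_permutations] using perm_parts w

/-- The image of a series in `(x, y)` after imposing `x_i y_j = y_j x_i` for all `i, j`: each
class of monomials is represented by a unique `x_u y_v`, and its coefficient is the sum of the
coefficients of the members of the class. -/
noncomputable def partialComm : NCQSym XY →ₗ[ℚ] (List ℕ+ × List ℕ+ → ℚ) where
  toFun g p := ∑ w ∈ (fiber_finite p.1 p.2).toFinset, g.1 w
  map_add' f g := by
    funext p
    simp [Finset.sum_add_distrib]
  map_smul' c f := by
    funext p
    simp [Finset.mul_sum]

/-- The series `f̄(x, y)`. -/
noncomputable def bar : NCQSym ℕ+ →ₗ[ℚ] (List ℕ+ × List ℕ+ → ℚ) :=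
  partialComm ∘ₗ evalAt XY

/-- The map `f ⊗ g ↦ f(x) g(y)` into the series in which the `x`- and `y`-variables commute. -/
noncomputable def tensorSeries :
    (NCQSym ℕ+ ⊗[ℚ] NCQSym ℕ+) →ₗ[ℚ] (List ℕ+ × List ℕ+ → ℚ) :=
  TensorProduct.lift (LinearMap.mk₂ ℚ (fun f g p => f.1 p.1 * g.1 p.2)
    (fun _ _ _ => by funext p; simp [add_mul])
    (fun _ _ _ => by funext p; simp [mul_assoc])
    (fun _ _ _ => by funext p; simp [mul_add])
    (fun _ _ _ => by funext p; simp [mul_left_comm]))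

@[simp] theorem tensorSeries_tmul (f g : NCQSym ℕ+) (p : List ℕ+ × List ℕ+) :
    tensorSeries (f ⊗ₜ g) p = f.1 p.1 * g.1 p.2 := rfl

theorem tensorSeries_injective : Function.Injective tensorSeries := by
  classical
  suffices key : ∀ t, tensorSeries t = 0 → t = 0 by
    intro s t h
    have h1 : tensorSeries (s + (-1 : ℚ) • t) = 0 := by
      rw [map_add, map_smul, h]
      simp
    have h2 : (-1 : ℚ) • t + t = 0 := by
      conv_lhs => rw [← one_smul ℚ t, smul_smul, ← add_smul]
      simp
    calc s = s + ((-1 : ℚ) • t + t) := by rw [h2, add_zero]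
      _ = t := by rw [← add_assoc, key _ h1, zero_add]
  intro t ht
  let b := Module.Basis.ofVectorSpace ℚ (NCQSym ℕ+)
  let c := TensorProduct.equivFinsuppOfBasisLeft (N := NCQSym ℕ+) b
  obtain ⟨m, rfl⟩ := c.symm.surjective t
  have hm : c.symm m = m.sum fun i n => b i ⊗ₜ[ℚ] n := by
    simp [c]
  suffices h : m = 0 by simp [h]
  rw [hm] at ht
  ext i v
  have h0 : ∑ k ∈ m.support, (m k).1 v • b k = 0 := by
    ext u
    have := congrFun ht (u, v)
    rw [Finsupp.sum, map_sum, Finset.sum_apply] at this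
    simpa [mul_comm] using this
  have hli := linearIndependent_iff'.1 b.linearIndependent m.support (fun k => (m k).1 v) h0
  by_cases hi : i ∈ m.support
  · simpa using hli i hi
  · simp [Finsupp.notMem_support_iff.1 hi]

/-- The monomial quasisymmetric function whose monomials are the words with packed form `p`. -/
noncomputable def monomial (p : List ℕ+) : NCQSym ℕ+ :=
  ⟨fun w => if pack w = p then 1 else 0, by
    refine ⟨⟨p.length, fun w hw => ?_⟩, fun n Φ i i' h h' => ?_⟩
    · have : pack w ≠ p := fun e => by
        have := congrArg List.length e
        simp at this
        omega
      simp [this]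
    · simp only [pack_ofFn_congr (h.lt_iff h')]⟩

theorem map_mem_fiber (g h : ℕ+ → ℕ+) {u v : List ℕ+} {w : List XY} (hw : w ∈ fiber u v) :
    w.map (fun a => toLex (Sum.map g h (ofLex a))) ∈ fiber (u.map g) (v.map h) := by
  obtain ⟨rfl, rfl⟩ := hw
  induction w with
  | nil => exact ⟨rfl, rfl⟩
  | cons a w ih =>
    obtain ⟨h1, h2⟩ := ih
    rcases a with a | a
    · exact ⟨congrArg (g a :: ·) h1, h2⟩
    · exact ⟨h1, congrArg (h a :: ·) h2⟩

theorem mem_of_mem_fiber {u v : List ℕ+} {w : List XY} (hw : w ∈ fiber u v) {a : XY}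
    (ha : a ∈ w) : (∃ b ∈ u, a = Sum.inlₗ b) ∨ ∃ b ∈ v, a = Sum.inrₗ b := by
  obtain ⟨rfl, rfl⟩ := hw
  have := (perm_parts w).subset ha
  simp only [List.mem_append, List.mem_map] at this
  rcases this with ⟨b, hb, rfl⟩ | ⟨b, hb, rfl⟩
  · exact Or.inl ⟨b, hb, rfl⟩
  · exact Or.inr ⟨b, hb, rfl⟩

theorem exists_rank (u : List ℕ+) : ∃ r s : ℕ+ → ℕ+, pack u = u.map r ∧
    StrictMonoOn r {a | a ∈ u} ∧ ∀ a ∈ u, s (r a) = a := by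
  set r : ℕ+ → ℕ+ := fun a => Nat.succPNat (u.toFinset.filter (· < a)).card with hr
  have hmono : StrictMonoOn r {a | a ∈ u} := by
    intro a ha b hb hab
    have : (u.toFinset.filter (· < a)).card < (u.toFinset.filter (· < b)).card := by
      apply Finset.card_lt_card
      rw [Finset.ssubset_iff_of_subset]
      · exact ⟨a, by simpa using ⟨ha, hab⟩, by simp⟩
      · intro c hc
        simp only [Finset.mem_filter] at hc ⊢
        exact ⟨hc.1, hc.2.trans hab⟩
    exact Nat.succPNat_lt_succPNat.2 this
  refine ⟨r, Function.invFunOn r {a | a ∈ u}, rfl, hmono, fun a ha => ?_⟩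
  exact hmono.injOn.leftInvOn_invFunOn ha

theorem bar_pack (f : NCQSym ℕ+) (u v : List ℕ+) : bar f (pack u, pack v) = bar f (u, v) := by
  obtain ⟨r, s, hu, hr, hs⟩ := exists_rank u
  obtain ⟨r', s', hv, hr', hs'⟩ := exists_rank v
  rw [hu, hv]
  symm
  change ∑ w ∈ (fiber_finite u v).toFinset, f.1 (pack w) =
    ∑ w ∈ (fiber_finite (u.map r) (v.map r')).toFinset, f.1 (pack w)
  have hsu : (u.map r).map s = u := by
    rw [List.map_map]
    conv_rhs => rw [← List.map_id u]
    exact List.map_congr_left fun a ha => hs a ha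
  have hsv : (v.map r').map s' = v := by
    rw [List.map_map]
    conv_rhs => rw [← List.map_id v]
    exact List.map_congr_left fun a ha => hs' a ha
  refine Finset.sum_bij' (fun w _ => w.map fun a => toLex (Sum.map r r' (ofLex a)))
    (fun w _ => w.map fun a => toLex (Sum.map s s' (ofLex a))) ?_ ?_ ?_ ?_ ?_
  · intro w hw
    simp only [Set.Finite.mem_toFinset] at hw ⊢
    exact map_mem_fiber r r' hw
  · intro w hw
    simp only [Set.Finite.mem_toFinset] at hw ⊢
    have := map_mem_fiber s s' hw
    rwa [hsu, hsv] at this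
  · intro w hw
    simp only [Set.Finite.mem_toFinset] at hw
    rw [List.map_map]
    conv_rhs => rw [← List.map_id w]
    refine List.map_congr_left fun a ha => ?_
    rcases mem_of_mem_fiber hw ha with ⟨b, hb, rfl⟩ | ⟨b, hb, rfl⟩
    · exact congrArg Sum.inlₗ (hs b hb)
    · exact congrArg Sum.inrₗ (hs' b hb)
  · intro w hw
    simp only [Set.Finite.mem_toFinset] at hw
    rw [List.map_map]
    conv_rhs => rw [← List.map_id w]
    refine List.map_congr_left fun a ha => ?_
    rcases mem_of_mem_fiber hw ha with ⟨b, hb, rfl⟩ | ⟨b, hb, rfl⟩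
    · obtain ⟨c, hc, rfl⟩ := List.mem_map.1 hb
      exact congrArg (fun z => Sum.inlₗ (r z)) (hs c hc)
    · obtain ⟨c, hc, rfl⟩ := List.mem_map.1 hb
      exact congrArg (fun z => Sum.inrₗ (r' z)) (hs' c hc)
  · intro w hw
    simp only [Set.Finite.mem_toFinset] at hw
    rw [pack_map]
    intro a ha b hb hab
    rcases mem_of_mem_fiber hw ha with ⟨c, hc, rfl⟩ | ⟨c, hc, rfl⟩ <;>
      rcases mem_of_mem_fiber hw hb with ⟨d, hd, rfl⟩ | ⟨d, hd, rfl⟩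
    · exact Sum.Lex.inl_lt_inl_iff.2 (hr hc hd (Sum.Lex.inl_lt_inl_iff.1 hab))
    · exact Sum.Lex.inl_lt_inr _ _
    · exact absurd hab Sum.Lex.not_inr_lt_inl
    · exact Sum.Lex.inr_lt_inr_iff.2 (hr' hc hd (Sum.Lex.inr_lt_inr_iff.1 hab))

theorem finite_packed (N : ℕ) : (pack '' {w : List ℕ+ | w.length ≤ N}).Finite := by
  refine ((List.finite_length_le (Fin (N + 1)) N).image
    (List.map fun k : Fin (N + 1) => Nat.succPNat k)).subset ?_
  rintro _ ⟨w, hw, rfl⟩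
  have hcard : ∀ a, (w.toFinset.filter (· < a)).card < N + 1 := fun a =>
    Nat.lt_succ_of_le ((Finset.card_filter_le _ _).trans ((List.toFinset_card_le w).trans hw))
  refine ⟨w.map fun a => ⟨_, hcard a⟩, by simpa using hw, ?_⟩
  simp [pack]

theorem bar_mem_range (f : NCQSym ℕ+) : bar f ∈ LinearMap.range tensorSeries := by
  classical
  obtain ⟨⟨N, hN⟩, -⟩ := f.2
  have hzero : ∀ u v : List ℕ+, N < u.length + v.length → bar f (u, v) = 0 := by
    intro u v h
    refine Finset.sum_eq_zero fun w hw => hN _ ?_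
    simp only [Set.Finite.mem_toFinset] at hw
    have := (perm_parts w).length_eq
    rw [hw.1, hw.2] at this
    simp only [List.length_append, List.length_map] at this
    rw [length_pack]
    omega
  set S := (finite_packed N).toFinset with hS
  refine ⟨∑ p ∈ S, ∑ q ∈ S, bar f (p, q) • (monomial p ⊗ₜ monomial q), ?_⟩
  funext ⟨u, v⟩
  have hmem : ∀ u : List ℕ+, u.length ≤ N → pack u ∈ S := fun u hu => by
    simp only [hS, Set.Finite.mem_toFinset]
    exact ⟨u, hu, rfl⟩
  simp only [map_sum, map_smul, Finset.sum_apply, Pi.smul_apply, tensorSeries_tmul, smul_eq_mul,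
    monomial, mul_ite, mul_one, mul_zero, Finset.sum_ite_eq]
  by_cases hu : u.length ≤ N
  · by_cases hv : v.length ≤ N
    · rw [← bar_pack f u v]
      simp [hmem u hu, hmem v hv]
    · rw [hzero u v (by omega)]
      refine Finset.sum_eq_zero fun p _ => ?_
      by_cases hq : pack v ∈ S
      · simp only [hS, Set.Finite.mem_toFinset] at hq
        obtain ⟨v', hv', e⟩ := hq
        have := congrArg List.length e
        simp only [length_pack] at this
        simp only [Set.mem_ofPred_eq] at hv'
        omega
      · simp [hq]
  · rw [hzero u v (by omega)]
    refine Finset.sum_eq_zero fun p hp => ?_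
    have : pack u ≠ p := by
      rintro rfl
      simp only [hS, Set.Finite.mem_toFinset] at hp
      obtain ⟨u', hu', e⟩ := hp
      have := congrArg List.length e
      simp only [length_pack] at this
      simp only [Set.mem_ofPred_eq] at hu'
      omega
    simp [this]

/-- The coproduct of `NCQSym`: `f̄(x, y)` lies in the image of the embedding `f ⊗ g ↦ f(x) g(y)` of
`NCQSym ⊗ NCQSym`, and `Δ f` is its preimage. -/
noncomputable def coproduct : NCQSym ℕ+ →ₗ[ℚ] NCQSym ℕ+ ⊗[ℚ] NCQSym ℕ+ :=
  (LinearEquiv.ofInjective tensorSeries tensorSeries_injective).symm.toLinearMap ∘ₗ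
    bar.codRestrict (LinearMap.range tensorSeries) bar_mem_range

/-! ### Labelled edge-coloured digraphs -/

/-- The three colours of edges: `⇢`, `→` and `⇒`. -/
inductive EdgeColour
  | dashed
  | solid
  | double

/-- A simple digraph on the vertex set `V` with a colour assigned to each edge. -/
structure EdgeColouredDigraph (V : Type*) extends Digraph V where
  loopless : ∀ a, ¬ Adj a a
  colour : {e : V × V // Adj e.1 e.2} → EdgeColour

namespace EdgeColouredDigraph

variable {V : Type*}

/-- `(a, b)` is an edge of `G` of colour `c`. -/
def HasEdge (G : EdgeColouredDigraph V) (c : EdgeColour) (a b : V) : Prop :=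
  ∃ h : G.Adj a b, G.colour ⟨(a, b), h⟩ = c

/-- Proper vertex-colourings. -/
def IsProper (G : EdgeColouredDigraph V) (κ : V → ℕ+) : Prop :=
  ∀ a b, (G.HasEdge .dashed a b → κ a ≠ κ b) ∧ (G.HasEdge .solid a b → κ a < κ b) ∧
    (G.HasEdge .double a b → κ a ≤ κ b)

/-- The induced subdigraph `G|_A`, with the colours of `G`. -/
def restrict (G : EdgeColouredDigraph V) (A : Finset V) : EdgeColouredDigraph A where
  Adj a b := G.Adj a b
  loopless a := G.loopless a
  colour e := G.colour ⟨(e.1.1, e.1.2), e.2⟩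

open Classical in
/-- The vertex sets `V(F)` of the `{→, ⇒}`-induced subdigraphs `F = G|_{V(F)}` of `G`: if
`a ∈ V(F)` and `a → b` or `a ⇒ b` in `G`, then `b ∈ V(F)`. -/
noncomputable def solidDoubleInduced [Fintype V] (G : EdgeColouredDigraph V) :
    Finset (Finset V) :=
  Finset.univ.filter fun A =>
    ∀ a b, a ∈ A → (G.HasEdge .solid a b ∨ G.HasEdge .double a b) → b ∈ A

/-- The monomial `x_{(κ, L)} = x_{κ(L⁻¹(1))} ⋯ x_{κ(L⁻¹(n))}` for a labelling `L : V → [n]`; here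
`[n]` is `Fin n`, so that `k : Fin n` stands for the label `k + 1`. -/
def word {n : ℕ} (L : V ≃ Fin n) (κ : V → ℕ+) : List ℕ+ := List.ofFn fun k => κ (L.symm k)

/-- The generalized chromatic function in noncommuting variables,
`𝒴_{(G, L)} = ∑_κ x_{(κ, L)}` over the proper vertex-colourings `κ` of `G`, for a bijective
labelling `L : V → [n]`, `n = |V|`: the coefficient of a monomial is the number of proper
vertex-colourings that contribute it. -/
noncomputable def chromatic (G : EdgeColouredDigraph V) {n : ℕ} (L : V ≃ Fin n) : NCQSym ℕ+ :=
  ⟨fun w => ({κ : V → ℕ+ | G.IsProper κ ∧ word L κ = w}.ncard : ℚ), by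
    refine ⟨⟨n, fun w hw => ?_⟩, fun m Φ i i' h h' => ?_⟩
    · have : {κ : V → ℕ+ | G.IsProper κ ∧ word L κ = w} = ∅ := by
        ext κ
        simp only [Set.mem_ofPred_eq, Set.mem_empty_iff_false, iff_false, not_and]
        rintro - rfl
        simp [word] at hw
      simp [this]
    · by_cases hm : m = n
      · subst hm
        have key : ∀ i : Fin m → ℕ+,
            {κ : V → ℕ+ | G.IsProper κ ∧ word L κ = List.ofFn i} =
              {κ | G.IsProper (i ∘ L) ∧ κ = i ∘ L} := by
          intro i
          ext κ
          have : word L κ = List.ofFn i ↔ κ = i ∘ L := by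
            rw [word, List.ofFn_inj]
            constructor
            · rintro rfl
              funext a
              simp
            · rintro rfl
              funext k
              simp
          simp only [Set.mem_ofPred_eq, this]
          constructor
          · rintro ⟨hp, rfl⟩
            exact ⟨hp, rfl⟩
          · rintro ⟨hp, rfl⟩
            exact ⟨hp, rfl⟩
        have hiff : G.IsProper (i ∘ L) ↔ G.IsProper (i' ∘ L) := by
          have hlt := h.lt_iff h'
          have hle : ∀ j l, i j ≤ i l ↔ i' j ≤ i' l := fun j l => by
            rw [← not_lt, ← not_lt, hlt]
          have heq : ∀ j l, i j = i l ↔ i' j = i' l := fun j l => by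
            rw [le_antisymm_iff, le_antisymm_iff, hle, hle]
          simp only [IsProper, Function.comp, ne_eq, hlt, hle, heq]
        simp only [key, hiff]
        by_cases hp : G.IsProper (i' ∘ L) <;> simp [hp]
      · have : ∀ i : Fin m → ℕ+, {κ : V → ℕ+ | G.IsProper κ ∧ word L κ = List.ofFn i} = ∅ := by
          intro i
          ext κ
          simp only [Set.mem_ofPred_eq, Set.mem_empty_iff_false, iff_false, not_and]
          rintro - e
          have := congrArg List.length e
          simp [word] at this
          omega
        simp only [this]⟩

end EdgeColouredDigraph

/-- The standardization `std_B`: the order preserving bijection from a finite set `B` of labels to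
`[|B|]`. -/
def std {n k : ℕ} (B : Finset (Fin n)) (h : B.card = k) : B ≃o Fin k := (B.orderIsoOfFin h).symm

/-- The labelling `L_A : A → [|A|]`, `a ↦ std_B (L a)` with `B = L(A)`. -/
def stdLabelling {V : Type*} {n : ℕ} (L : V ≃ Fin n) (A : Finset V) : A ≃ Fin A.card where
  toFun a := std (A.map L.toEmbedding) (Finset.card_map _)
    ⟨L a, Finset.mem_map_of_mem L.toEmbedding a.2⟩
  invFun k := ⟨L.symm ((std (A.map L.toEmbedding) (Finset.card_map _)).symm k), by
    have := ((std (A.map L.toEmbedding) (Finset.card_map _)).symm k).2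
    obtain ⟨a, ha, e⟩ := Finset.mem_map.1 this
    rw [← e]
    simpa using ha⟩
  left_inv a := by simp
  right_inv k := by simp

end NCQ

namespace NCQ

/-! Since `tensorSeries` is injective, it suffices to compare the coefficients of x_u y_v.
Properness of a colouring depends only on the relative order of its colours, so evaluating the
chromatic function at x₁ < x₂ < ⋯ < y₁ < y₂ < ⋯ enumerates proper colourings with values in that
alphabet (`chromatic_pack`). After x and y are made to commute, the coefficient counts those whose
word has x-part u and y-part v (`bar_chromatic`).

Sort these colourings by the set F of vertices that receive a y. Every y exceeds every x, so no → or
⇒ edge leaves F. Conversely, for such an F the edges between F and its complement hold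
automatically, so a proper colouring is a free choice of proper colourings of the two induced
subdigraphs (`isProperIn_glue`). Extracting the x- or y-letters keeps the order of the labels, which
is exactly standardization (`ofFn_glue_mem_fiber`). The count is therefore a sum over F of products
(`card_isProperIn_fiber`). -/

theorem tensorSeries_coproduct (f : NCQSym ℕ+) : tensorSeries (coproduct f) = bar f := by
  have h := (LinearEquiv.ofInjective tensorSeries tensorSeries_injective).apply_symm_apply
    (bar.codRestrict (LinearMap.range tensorSeries) bar_mem_range f)
  exact congrArg Subtype.val h

theorem bar_apply (f : NCQSym ℕ+) (u v : List ℕ+) :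
    bar f (u, v) = ∑ w ∈ (fiber_finite u v).toFinset, f.1 (pack w) := rfl

/-! ### Order patterns of words and enumeration of label sets -/

theorem exists_pack_ofFn {A : Type} [LinearOrder A] {n : ℕ} (i : Fin n → A) :
    ∃ i' : Fin n → ℕ+, pack (List.ofFn i) = List.ofFn i' ∧
      ∀ j l, i j < i l ↔ i' j < i' l := by
  set w := List.ofFn i with hw
  refine ⟨fun j => Nat.succPNat (w.toFinset.filter (· < i j)).card, ?_, ?_⟩
  · conv_lhs => rw [pack, hw, List.map_ofFn]
    rfl
  · have hmono : ∀ j l, i j < i l → (w.toFinset.filter (· < i j)).card <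
        (w.toFinset.filter (· < i l)).card := by
      intro j l hjl
      apply Finset.card_lt_card
      rw [Finset.ssubset_iff_of_subset]
      -- The letter `i j` lies below `i l` but not below itself, so the inclusion is strict.
      · exact ⟨i j, by simp [hw, hjl], by simp⟩
      · intro c hc
        simp only [Finset.mem_filter] at hc ⊢
        exact ⟨hc.1, hc.2.trans hjl⟩
    intro j l
    rw [Nat.succPNat_lt_succPNat]
    refine ⟨hmono j l, fun h => ?_⟩
    by_contra hle
    rcases (not_lt.1 hle).lt_or_eq with hlt | heq
    · exact h.asymm (hmono l j hlt)
    · rw [heq] at h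
      exact lt_irrefl _ h

/-- Enumerating `Fin n` in increasing order and keeping the values of `g` at the elements of `B`
amounts to enumerating `B` in increasing order. -/
theorem filterMap_finRange_eq_ofFn {n k : ℕ} {α : Type*} (B : Finset (Fin n)) (hB : B.card = k)
    (g : B → α) (p : Fin n → Option α) (hp : ∀ j (hj : j ∈ B), p j = some (g ⟨j, hj⟩))
    (hp' : ∀ j ∉ B, p j = none) :
    (List.finRange n).filterMap p = List.ofFn fun j => g ((std B hB).symm j) := by
  -- Factoring `p` through membership in `B` reduces the claim to `g = id`.
  have hpe : p = fun j => (if hj : j ∈ B then some (⟨j, hj⟩ : B) else none).map g := by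
    funext j
    by_cases hj : j ∈ B
    · simp [hj, hp j hj]
    · simp [hj, hp' j hj]
  have key : (List.finRange n).filterMap (fun j => if hj : j ∈ B then some (⟨j, hj⟩ : B) else none)
      = List.ofFn (std B hB).symm := by
    -- Both lists are strictly increasing and contain every element of `B`, hence they coincide.
    refine List.SortedLT.eq_of_mem_iff ?_ ?_ ?_
    · rw [List.sortedLT_iff_pairwise, List.pairwise_filterMap]
      refine (List.sortedLT_iff_pairwise.1 (List.sortedLT_finRange n)).imp ?_
      intro a b hab c hc d hd
      split_ifs at hc hd
      simp only [Option.some.injEq] at hc hd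
      subst hc hd
      exact hab
    · exact (std B hB).symm.strictMono.sortedLT_ofFn
    · intro a
      simp only [List.mem_filterMap, List.mem_finRange, true_and, List.mem_ofFn']
      refine iff_of_true ⟨a, by simp⟩ ((std B hB).symm.surjective a)
  have : List.ofFn (fun j => g ((std B hB).symm j)) = (List.ofFn (std B hB).symm).map g := by
    rw [List.map_ofFn]
    rfl
  rw [this, ← key, List.map_filterMap, hpe]

/-! ### Chromatic functions evaluated at a linearly ordered alphabet -/

namespace EdgeColouredDigraph

variable {V : Type*}

/-- Proper vertex-colourings with colours in a linearly ordered alphabet. -/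
def IsProperIn (G : EdgeColouredDigraph V) {A : Type} [LinearOrder A] (κ : V → A) : Prop :=
  ∀ a b, (G.HasEdge .dashed a b → κ a ≠ κ b) ∧ (G.HasEdge .solid a b → κ a < κ b) ∧
    (G.HasEdge .double a b → κ a ≤ κ b)

theorem isProper_iff_isProperIn (G : EdgeColouredDigraph V) {A : Type} [LinearOrder A]
    {κ : V → A} {κ' : V → ℕ+} (h : ∀ a b, κ a < κ b ↔ κ' a < κ' b) :
    G.IsProper κ' ↔ G.IsProperIn κ := by
  have hle : ∀ a b, κ a ≤ κ b ↔ κ' a ≤ κ' b := fun a b => by rw [← not_lt, ← not_lt, h]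
  have heq : ∀ a b, κ a = κ b ↔ κ' a = κ' b := fun a b => by
    rw [le_antisymm_iff, le_antisymm_iff, hle, hle]
  simp only [IsProper, IsProperIn, ne_eq, h, hle, heq]

/-- As `L` is a bijection, a word of length `n` comes from exactly one colouring; every coefficient
of a chromatic function is thus 0 or 1. -/
theorem ofFn_comp_symm_eq_iff {A : Type} {n : ℕ} (L : V ≃ Fin n) (κ : V → A) (i : Fin n → A) :
    (List.ofFn fun k => κ (L.symm k)) = List.ofFn i ↔ κ = i ∘ L := by
  rw [List.ofFn_inj]
  constructor
  · rintro rfl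
    funext a
    simp
  · rintro rfl
    funext k
    simp

/-- The evaluation of the chromatic function at an alphabet `A` counts the proper colourings
with values in `A`. -/
theorem chromatic_pack (G : EdgeColouredDigraph V) {n : ℕ} (L : V ≃ Fin n) {A : Type}
    [LinearOrder A] (w : List A) :
    (G.chromatic L).1 (pack w) =
      ({κ : V → A | G.IsProperIn κ ∧ (List.ofFn fun k => κ (L.symm k)) = w}.ncard : ℚ) := by
  change (({κ : V → ℕ+ | G.IsProper κ ∧ word L κ = pack w}.ncard : ℕ) : ℚ) = _
  congr 1
  -- In length `n` each side tests the properness of a single colouring; in any other length both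
  -- sets are empty.
  by_cases hw : w.length = n
  · obtain ⟨i, rfl⟩ : ∃ i : Fin n → A, w = List.ofFn i := by
      subst hw
      exact ⟨_, (List.ofFn_get w).symm⟩
    obtain ⟨i', hi', hlt⟩ := exists_pack_ofFn i
    have h1 : {κ : V → ℕ+ | G.IsProper κ ∧ word L κ = pack (List.ofFn i)} =
        {κ | G.IsProper (i' ∘ L) ∧ κ = i' ∘ L} := by
      ext κ
      rw [Set.mem_ofPred_eq, hi', word, ofFn_comp_symm_eq_iff]
      exact and_congr_left fun e => by rw [e]
    have h2 : {κ : V → A | G.IsProperIn κ ∧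
          (List.ofFn fun k => κ (L.symm k)) = List.ofFn i} =
        {κ | G.IsProperIn (i ∘ L) ∧ κ = i ∘ L} := by
      ext κ
      rw [Set.mem_ofPred_eq, ofFn_comp_symm_eq_iff]
      exact and_congr_left fun e => by rw [e]
    have h3 : G.IsProper (i' ∘ L) ↔ G.IsProperIn (i ∘ L) :=
      isProper_iff_isProperIn G fun a b => hlt _ _
    rw [h1, h2, h3]
    by_cases hp : G.IsProperIn (i ∘ L) <;> simp [hp]
  · have h1 : {κ : V → ℕ+ | G.IsProper κ ∧ word L κ = pack w} = ∅ := by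
      refine Set.eq_empty_of_forall_notMem ?_
      rintro κ ⟨-, e⟩
      exact hw (by rw [← length_pack w, ← e]; simp [word])
    have h2 : {κ : V → A | G.IsProperIn κ ∧ (List.ofFn fun k => κ (L.symm k)) = w} = ∅ := by
      refine Set.eq_empty_of_forall_notMem ?_
      rintro κ ⟨-, e⟩
      exact hw (by simp [← e])
    rw [h1, h2, Set.ncard_empty, Set.ncard_empty]

/-- Keeping the letters of a word in increasing order of the labels of the vertices in `A` gives
the word of the standardized labelling of `A`. -/
theorem filterMap_ofFn_eq_word {n : ℕ} (L : V ≃ Fin n) (A : Finset V) (κ : V → XY) (κ' : A → ℕ+)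
    (p : XY → Option ℕ+) (hp : ∀ a (ha : a ∈ A), p (κ a) = some (κ' ⟨a, ha⟩))
    (hp' : ∀ a ∉ A, p (κ a) = none) :
    (List.ofFn fun k => κ (L.symm k)).filterMap p = word (stdLabelling L A) κ' := by
  have hmem : ∀ k, k ∈ A.map L.toEmbedding ↔ L.symm k ∈ A := fun k => by
    simp [Finset.mem_map_equiv]
  rw [List.ofFn_eq_map, List.filterMap_map,
    filterMap_finRange_eq_ofFn (A.map L.toEmbedding) (Finset.card_map _)
      (fun k => κ' ⟨L.symm k, (hmem k).1 k.2⟩)]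
  -- The inverse of `stdLabelling L A` is by definition `L.symm` after the inverse of `std`.
  · rfl
  · intro j hj
    exact hp _ ((hmem j).1 hj)
  · intro j hj
    exact hp' _ (mt (hmem j).2 hj)

/-! ### Splitting a colouring into its x-coloured and y-coloured vertices -/

/-- The colouring with values in `x₁ < x₂ < ⋯ < y₁ < y₂ < ⋯` given by a colouring of the
complement of `F` by `x`-variables and a colouring of `F` by `y`-variables. -/
def glue [Fintype V] [DecidableEq V] (F : Finset V) (κ : (↥Fᶜ → ℕ+) × (F → ℕ+)) (a : V) : XY :=
  if h : a ∈ F then Sum.inrₗ (κ.2 ⟨a, h⟩) else Sum.inlₗ (κ.1 ⟨a, Finset.mem_compl.2 h⟩)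

section glue

variable [Fintype V] [DecidableEq V] (G : EdgeColouredDigraph V) (F : Finset V)

theorem glue_of_mem (κ : (↥Fᶜ → ℕ+) × (F → ℕ+)) {a : V} (h : a ∈ F) :
    glue F κ a = Sum.inrₗ (κ.2 ⟨a, h⟩) := dif_pos h

theorem glue_of_notMem (κ : (↥Fᶜ → ℕ+) × (F → ℕ+)) {a : V} (h : a ∉ F) :
    glue F κ a = Sum.inlₗ (κ.1 ⟨a, Finset.mem_compl.2 h⟩) := dif_neg h

theorem glue_injective : Function.Injective (glue F) := by
  intro κ κ' h
  refine Prod.ext (funext fun a => ?_) (funext fun a => ?_)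
  · have := congrFun h a
    rw [glue_of_notMem F _ (Finset.mem_compl.1 a.2),
      glue_of_notMem F _ (Finset.mem_compl.1 a.2)] at this
    exact Sum.inl_injective (toLex.injective this)
  · have := congrFun h a
    rw [glue_of_mem F _ a.2, glue_of_mem F _ a.2] at this
    exact Sum.inr_injective (toLex.injective this)

/-- Together with `glue_injective` and `isRight_glue`, this makes `glue F` a bijection onto the
colourings whose y-coloured vertices are exactly those of `F`. -/
theorem exists_glue_eq (κ : V → XY) (hF : ∀ a, a ∈ F ↔ (ofLex (κ a)).isRight) :
    ∃ κ', glue F κ' = κ := by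
  have hr : ∀ a : F, ∃ c, κ a = Sum.inrₗ c := fun a => by
    obtain ⟨c, hc⟩ := Sum.isRight_iff.1 ((hF a).1 a.2)
    exact ⟨c, hc⟩
  have hl : ∀ a : ↥Fᶜ, ∃ c, κ a = Sum.inlₗ c := fun a => by
    have h := (not_congr (hF a)).1 (Finset.mem_compl.1 a.2)
    rw [Sum.not_isRight] at h
    obtain ⟨c, hc⟩ := Sum.isLeft_iff.1 h
    exact ⟨c, hc⟩
  choose r hr using hr
  choose l hl using hl
  refine ⟨(l, r), funext fun a => ?_⟩
  by_cases h : a ∈ F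
  · rw [glue_of_mem F _ h, hr ⟨a, h⟩]
  · rw [glue_of_notMem F _ h, hl ⟨a, Finset.mem_compl.2 h⟩]

theorem isRight_glue (κ : (↥Fᶜ → ℕ+) × (F → ℕ+)) (a : V) :
    (ofLex (glue F κ a)).isRight ↔ a ∈ F := by
  by_cases h : a ∈ F
  · rw [glue_of_mem F κ h]
    exact iff_of_true rfl h
  · rw [glue_of_notMem F κ h]
    exact iff_of_false Bool.false_ne_true h

/-- A → or ⇒ edge leaving `F` would force some y to be at most some x. -/
theorem mem_solidDoubleInduced_of_isProperIn {κ : V → XY} (hκ : G.IsProperIn κ)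
    (hF : ∀ a, a ∈ F ↔ (ofLex (κ a)).isRight) : F ∈ G.solidDoubleInduced := by
  obtain ⟨κ, rfl⟩ := exists_glue_eq F κ hF
  simp only [solidDoubleInduced, Finset.mem_filter, Finset.mem_univ, true_and]
  intro a b ha h
  have hle : glue F κ a ≤ glue F κ b := h.elim (fun h => ((hκ a b).2.1 h).le) (hκ a b).2.2
  by_contra hb
  rw [glue_of_mem F κ ha, glue_of_notMem F κ hb] at hle
  exact Sum.Lex.not_inr_le_inl hle

theorem isProperIn_glue (hF : F ∈ G.solidDoubleInduced) (κ : (↥Fᶜ → ℕ+) × (F → ℕ+)) :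
    G.IsProperIn (glue F κ) ↔ (G.restrict Fᶜ).IsProper κ.1 ∧ (G.restrict F).IsProper κ.2 := by
  simp only [solidDoubleInduced, Finset.mem_filter, Finset.mem_univ, true_and] at hF
  constructor
  · intro h
    refine ⟨fun a b => ?_, fun a b => ?_⟩
    · have hab := h a b
      rw [glue_of_notMem F κ (Finset.mem_compl.1 a.2),
        glue_of_notMem F κ (Finset.mem_compl.1 b.2)] at hab
      exact ⟨fun e he => hab.1 e (congrArg _ he), fun e => Sum.Lex.inl_lt_inl_iff.1 (hab.2.1 e),
        fun e => Sum.Lex.inl_le_inl_iff.1 (hab.2.2 e)⟩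
    · have hab := h a b
      rw [glue_of_mem F κ a.2, glue_of_mem F κ b.2] at hab
      exact ⟨fun e he => hab.1 e (congrArg _ he), fun e => Sum.Lex.inr_lt_inr_iff.1 (hab.2.1 e),
        fun e => Sum.Lex.inr_le_inr_iff.1 (hab.2.2 e)⟩
  · rintro ⟨h1, h2⟩ a b
    by_cases ha : a ∈ F <;> by_cases hb : b ∈ F
    · rw [glue_of_mem F κ ha, glue_of_mem F κ hb]
      have hab := h2 ⟨a, ha⟩ ⟨b, hb⟩
      exact ⟨fun e he => hab.1 e (Sum.inr_injective (toLex.injective he)),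
        fun e => Sum.Lex.inr_lt_inr_iff.2 (hab.2.1 e),
        fun e => Sum.Lex.inr_le_inr_iff.2 (hab.2.2 e)⟩
    -- From `F` to its complement only dashed edges can occur, and an x never equals a y.
    · rw [glue_of_mem F κ ha, glue_of_notMem F κ hb]
      exact ⟨fun _ => (Sum.Lex.inl_lt_inr _ _).ne', fun e => absurd (hF a b ha (Or.inl e)) hb,
        fun e => absurd (hF a b ha (Or.inr e)) hb⟩
    -- From the complement into `F`, the inequality x < y satisfies all three colours at once.
    · rw [glue_of_notMem F κ ha, glue_of_mem F κ hb]
      exact ⟨fun _ => (Sum.Lex.inl_lt_inr _ _).ne, fun _ => Sum.Lex.inl_lt_inr _ _,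
        fun _ => (Sum.Lex.inl_lt_inr _ _).le⟩
    · rw [glue_of_notMem F κ ha, glue_of_notMem F κ hb]
      have hab := h1 ⟨a, Finset.mem_compl.2 ha⟩ ⟨b, Finset.mem_compl.2 hb⟩
      exact ⟨fun e he => hab.1 e (Sum.inl_injective (toLex.injective he)),
        fun e => Sum.Lex.inl_lt_inl_iff.2 (hab.2.1 e),
        fun e => Sum.Lex.inl_le_inl_iff.2 (hab.2.2 e)⟩

theorem ofFn_glue_mem_fiber {n : ℕ} (L : V ≃ Fin n) (κ : (↥Fᶜ → ℕ+) × (F → ℕ+))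
    (u v : List ℕ+) :
    (List.ofFn fun k => glue F κ (L.symm k)) ∈ fiber u v ↔
      word (stdLabelling L Fᶜ) κ.1 = u ∧ word (stdLabelling L F) κ.2 = v := by
  have hx : xPart (List.ofFn fun k => glue F κ (L.symm k)) = word (stdLabelling L Fᶜ) κ.1 := by
    refine filterMap_ofFn_eq_word L Fᶜ _ _ _ (fun a ha => ?_) (fun a ha => ?_)
    · rw [glue_of_notMem F κ (Finset.mem_compl.1 ha)]
      rfl
    · rw [glue_of_mem F κ (by simpa using ha)]
      rfl
  have hy : yPart (List.ofFn fun k => glue F κ (L.symm k)) = word (stdLabelling L F) κ.2 := by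
    refine filterMap_ofFn_eq_word L F _ _ _ (fun a ha => ?_) (fun a ha => ?_)
    · rw [glue_of_mem F κ ha]
      rfl
    · rw [glue_of_notMem F κ ha]
      rfl
  change xPart _ = u ∧ yPart _ = v ↔ _
  rw [hx, hy]

end glue

/-! ### Counting colourings coefficient by coefficient -/

theorem ofFn_comp_symm_injective {A : Type} {n : ℕ} (L : V ≃ Fin n) :
    Function.Injective fun κ : V → A => List.ofFn fun k => κ (L.symm k) := fun κ κ' h => by
  have := (ofFn_comp_symm_eq_iff L κ fun k => κ' (L.symm k)).1 h
  rw [this]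
  funext a
  simp

theorem finite_isProperIn_fiber (G : EdgeColouredDigraph V) {n : ℕ} (L : V ≃ Fin n)
    (u v : List ℕ+) :
    {κ : V → XY | G.IsProperIn κ ∧ (List.ofFn fun k => κ (L.symm k)) ∈ fiber u v}.Finite :=
  ((fiber_finite u v).preimage (ofFn_comp_symm_injective L).injOn).subset fun _ h => h.2

/-- The words in `fiber u v` partition these colourings, and `chromatic_pack` counts each class. -/
theorem bar_chromatic (G : EdgeColouredDigraph V) {n : ℕ} (L : V ≃ Fin n) (u v : List ℕ+) :
    bar (G.chromatic L) (u, v) = ((finite_isProperIn_fiber G L u v).toFinset.card : ℚ) := by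
  classical
  rw [bar_apply, Finset.card_eq_sum_card_fiberwise (f := fun κ => List.ofFn fun k => κ (L.symm k))
    (t := (fiber_finite u v).toFinset), Nat.cast_sum]
  · refine Finset.sum_congr rfl fun w hw => ?_
    rw [chromatic_pack, ← Set.ncard_coe_finset]
    congr 2
    ext κ
    simp only [Set.Finite.mem_toFinset] at hw
    simp only [Finset.coe_filter, Set.Finite.mem_toFinset, Set.mem_ofPred_eq]
    constructor
    · rintro ⟨h, rfl⟩
      exact ⟨⟨h, hw⟩, rfl⟩
    · rintro ⟨⟨h, -⟩, rfl⟩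
      exact ⟨h, rfl⟩
  · intro κ hκ
    simp only [Finset.mem_coe, Set.Finite.mem_toFinset] at hκ ⊢
    exact hκ.2

theorem card_isProperIn_fiber [Fintype V] [DecidableEq V] (G : EdgeColouredDigraph V) {n : ℕ}
    (L : V ≃ Fin n) (u v : List ℕ+) :
    (finite_isProperIn_fiber G L u v).toFinset.card = ∑ F ∈ G.solidDoubleInduced,
      {κ | (G.restrict Fᶜ).IsProper κ ∧ word (stdLabelling L Fᶜ) κ = u}.ncard *
        {κ | (G.restrict F).IsProper κ ∧ word (stdLabelling L F) κ = v}.ncard := by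
  -- The classes are indexed by the set of y-coloured vertices.
  rw [Finset.card_eq_sum_card_fiberwise
    (f := fun κ : V → XY => Finset.univ.filter fun a => (ofLex (κ a)).isRight)
    (t := G.solidDoubleInduced)]
  · refine Finset.sum_congr rfl fun F hF => ?_
    -- The product of counts becomes the size of the image under `glue F`, to be matched with the
    -- class of `F`.
    rw [← Set.ncard_prod, ← Set.ncard_image_of_injective _ (glue_injective F),
      ← Set.ncard_coe_finset]
    congr 1
    ext κ
    simp only [Finset.coe_filter, Set.Finite.mem_toFinset, Set.mem_ofPred_eq, Set.mem_image,
      Set.mem_prod]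
    constructor
    · rintro ⟨⟨h, hw⟩, hκ⟩
      obtain ⟨κ, rfl⟩ := exists_glue_eq F κ fun a => by simp [← hκ]
      rw [isProperIn_glue G F hF] at h
      rw [ofFn_glue_mem_fiber] at hw
      exact ⟨κ, ⟨⟨h.1, hw.1⟩, h.2, hw.2⟩, rfl⟩
    · rintro ⟨κ, ⟨⟨h1, hw1⟩, h2, hw2⟩, rfl⟩
      refine ⟨⟨(isProperIn_glue G F hF κ).2 ⟨h1, h2⟩,
        (ofFn_glue_mem_fiber F L κ u v).2 ⟨hw1, hw2⟩⟩, ?_⟩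
      ext a
      simp only [Finset.mem_filter, Finset.mem_univ, true_and, isRight_glue]
  · intro κ hκ
    simp only [Finset.mem_coe, Set.Finite.mem_toFinset] at hκ ⊢
    exact mem_solidDoubleInduced_of_isProperIn G _ hκ.1 fun a => by simp

end EdgeColouredDigraph

end NCQ

theorem mainTheorem9 {V : Type*} [Fintype V] [DecidableEq V] (G : NCQ.EdgeColouredDigraph V)
    {n : ℕ} (L : V ≃ Fin n) :
    NCQ.coproduct (G.chromatic L) =
      ∑ F ∈ G.solidDoubleInduced,
        (G.restrict Fᶜ).chromatic (NCQ.stdLabelling L Fᶜ) ⊗ₜ[ℚ]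
          (G.restrict F).chromatic (NCQ.stdLabelling L F) := by
  apply NCQ.tensorSeries_injective
  rw [NCQ.tensorSeries_coproduct]
  funext ⟨u, v⟩
  rw [G.bar_chromatic, G.card_isProperIn_fiber, map_sum, Finset.sum_apply, Nat.cast_sum]
  refine Finset.sum_congr rfl fun F _ => ?_
  rw [NCQ.tensorSeries_tmul, Nat.cast_mul]
  -- The coefficients of `chromatic` are by definition these cardinalities.
  rfl
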